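/- Conventions. A subset $S$ of a group $G$ is called \emph{regular} if there are a finite alphabet $X$, a surjective monoid homomorphism $\pi\colon X^*\to G$ and a regular language $\mathcal L\subseteq X^*$ (one accepted by a finite state automaton) with $\pi(\mathcal L)=S$. For a subgroup $H\le G$, a \emph{positive cone of $G$ relative to $H$} is a (possibly empty) subset $P\subseteq G$ with $PP\subseteq P$ such that $G$ is the disjoint union $P\sqcup H\sqcup P^{-1}$; a \emph{positive cone} of $G$ is a positive cone relative to $\{1\}$. A \emph{left-order} on $G$ is a strict total order $\prec$ on $G$ such that $a\prec b\Leftrightarrow ca\prec cb$ for all $a,b,c\in G$; it is \emph{regular} if $\{g\in G: 1\prec g\}$ is a regular subset of $G$. Theorem. Let $G_1,\dots,G_n$ be finitely generated groups with a common subgroup $C$ (that is, $C$ is a group with a given injective homomorphism $C\hookrightarrow G_i$ for each $i$). Suppose that each $G_i$ admits a regular positive cone relative to (the image of) $C$, and that $C$ admits a regular positive cone. Let $G=G_1*_C\cdots*_C G_n$ be the free product of the $G_i$ amalgamated over $C$. Then $G\times\mathbb Z$ admits a regular left-order. -/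

import Mathlib

namespace RegularOrder

universe u

variable {G : Type u} [Group G]

/-- A subset `S` of `G` is the evaluation of a regular language: there are a finite alphabet `X`, a
surjective monoid homomorphism `π : X* → G` (a finite monoid generating set of `G`) and a regular
language `L ⊆ X*` with `π(L) = S`. -/
def IsRegularSubset (S : Set G) : Prop :=
  ∃ (X : Type) (_ : Finite X) (π : FreeMonoid X →* G) (L : Language X),
    Function.Surjective π ∧ L.IsRegular ∧ {g : G | ∃ w ∈ L, π (FreeMonoid.ofList w) = g} = S

/-- `P` is a positive cone relative to the subgroup `H`: `P` is a subsemigroup and `G` is the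
disjoint union of `P`, `H` and `P⁻¹`. -/
structure IsRelPositiveCone (P : Set G) (H : Subgroup G) : Prop where
  mul_mem : ∀ g ∈ P, ∀ h ∈ P, g * h ∈ P
  cover : ∀ g : G, g ∈ P ∨ g ∈ H ∨ g⁻¹ ∈ P
  disjoint_subgroup : ∀ g ∈ P, g ∉ H
  disjoint_inv : ∀ g ∈ P, g⁻¹ ∉ P

/-- `P` is a positive cone of `G`: `P` is a subsemigroup and `G` is the disjoint union of `P`,
`{1}` and `P⁻¹`. -/
structure IsPositiveCone (P : Set G) : Prop where
  mul_mem : ∀ g ∈ P, ∀ h ∈ P, g * h ∈ P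
  cover : ∀ g : G, g ∈ P ∨ g = 1 ∨ g⁻¹ ∈ P
  one_notMem : (1 : G) ∉ P
  disjoint_inv : ∀ g ∈ P, g⁻¹ ∉ P

/-- `r` is a (strict) left-order on `G`: a strict total order invariant under left
multiplication. -/
structure IsLeftOrder (r : G → G → Prop) : Prop where
  isStrictTotalOrder : IsStrictTotalOrder G r
  mul_left_iff : ∀ a b c : G, r a b ↔ r (c * a) (c * b)

variable (G) in
/-- `G` admits a regular positive cone. -/
def HasRegularPositiveCone : Prop :=
  ∃ P : Set G, IsPositiveCone P ∧ IsRegularSubset P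

/-- `G` admits a regular positive cone relative to `H`. -/
def HasRegularRelPositiveCone (H : Subgroup G) : Prop :=
  ∃ P : Set G, IsRelPositiveCone P H ∧ IsRegularSubset P

variable (G) in
/-- `G` admits a regular left-order: a left-order whose set of positive elements is the evaluation
of a regular language. -/
def HasRegularLeftOrder : Prop :=
  ∃ r : G → G → Prop, IsLeftOrder r ∧ IsRegularSubset {g : G | r 1 g}

end RegularOrder

/-!
Write an element of the amalgamated product as `x₁ * ⋯ * xₙ * c` with letters `xᵢ` outside of `C`,
consecutive ones in different factors, and `c ∈ C`. Add up the signs of the letters with respect to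
the relative positive cones, and `±1` for each pair of consecutive letters according to the order of
their factors. This weight is `0` on `C` and odd elsewhere, and cancellation in a product changes it
by at most `1`. Hence the pairs `(g, m)` with `2 * m + weight g > 0` form a positive cone of `G × ℤ`
relative to `C`, which a positive cone of `C` completes to one of `G × ℤ`.

Since signs and turns both are odd, the contribution of a letter and the turn after it is even and
can be compensated at once by the coordinate in `ℤ`. The only memory needed to recognize
`2 * m + weight g > 0` along a reduced word is thus the factor of the next letter, so the cone is
the evaluation of a finite automaton over rational sets.
-/

namespace RegularOrder

open scoped Computability Pointwise

section Language

variable {α : Type*} {L K : Language α}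

/-- The union of the left quotients of `K` by the words `v` such that `x ∈ L * {v}`. It collects
the words that complete `x` to an element of `L * K` by extending the factor in `K`. -/
def splitQuotient (L K : Language α) (x : List α) : Language α :=
  {w | ∃ u ∈ L, ∃ v, u ++ v = x ∧ w ∈ K.leftQuotient v}

theorem finite_range_splitQuotient (L : Language α) (hK : K.IsRegular) :
    (Set.range (splitQuotient L K)).Finite := by
  refine (hK.finite_range_leftQuotient.powerset.image fun 𝒜 => (⋃₀ 𝒜 : Set (List α))).subset ?_
  rintro _ ⟨x, rfl⟩
  refine ⟨K.leftQuotient '' {v | ∃ u ∈ L, u ++ v = x}, Set.image_subset_range _ _, ?_⟩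
  ext w
  constructor
  · rintro ⟨_, ⟨v, ⟨u, hu, huv⟩, rfl⟩, hw⟩
    exact ⟨u, hu, v, huv, hw⟩
  · rintro ⟨u, hu, v, huv, hw⟩
    exact ⟨_, ⟨v, ⟨u, hu, huv⟩, rfl⟩, hw⟩

theorem leftQuotient_mul (L K : Language α) (x : List α) :
    (L * K).leftQuotient x = L.leftQuotient x * K + splitQuotient L K x := by
  ext w
  rw [Language.mem_leftQuotient, Language.mem_add, Language.mem_mul, Language.mem_mul]
  constructor
  · rintro ⟨a, ha, b, hb, h⟩
    rcases List.append_eq_append_iff.1 h with ⟨v, rfl, rfl⟩ | ⟨v, rfl, rfl⟩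
    · exact .inr ⟨a, ha, v, rfl, hb⟩
    · exact .inl ⟨v, ha, b, hb, rfl⟩
  · rintro (⟨a, ha, b, hb, rfl⟩ | ⟨u, hu, v, rfl, hw⟩)
    · exact ⟨x ++ a, ha, b, hb, List.append_assoc ..⟩
    · exact ⟨u, hu, v ++ w, hw, (List.append_assoc ..).symm⟩

theorem isRegular_mul (hL : L.IsRegular) (hK : K.IsRegular) : (L * K).IsRegular := by
  refine .of_finite_range_leftQuotient <| (Set.Finite.image2 (fun A B => A * K + B)
    hL.finite_range_leftQuotient (finite_range_splitQuotient L hK)).subset ?_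
  rintro _ ⟨x, rfl⟩
  exact ⟨_, ⟨x, rfl⟩, _, ⟨x, rfl⟩, (leftQuotient_mul L K x).symm⟩

theorem append_mem_kstar {u v : List α} (hu : u ∈ L∗) (hv : v ∈ L∗) : u ++ v ∈ L∗ := by
  simpa only [kstar_mul_kstar] using Language.append_mem_mul hu hv

theorem mem_kstar_of_mem {u : List α} (hu : u ∈ L) : u ∈ L∗ :=
  le_kstar (α := Language α) hu

theorem leftQuotient_kstar (L : Language α) {x : List α} (hx : x ≠ []) :
    (L∗).leftQuotient x = splitQuotient (L∗) L x * L∗ := by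
  ext w
  rw [Language.mem_leftQuotient]
  constructor
  · rw [Language.mem_kstar]
    rintro ⟨M, hM, hML⟩
    induction M generalizing x with
    | nil => exact absurd (List.append_eq_nil_iff.1 hM).1 hx
    | cons y M ih =>
      obtain ⟨hy, hM'⟩ := List.forall_mem_cons.1 hML
      rw [List.flatten_cons] at hM
      rcases List.append_eq_append_iff.1 hM with ⟨a, rfl, rfl⟩ | ⟨c, rfl, hc⟩
      · exact ⟨a, ⟨[], Language.nil_mem_kstar _, x, rfl, hy⟩, _, Language.join_mem_kstar hM', rfl⟩
      · rcases eq_or_ne c [] with rfl | hne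
        · refine ⟨[], ⟨[], Language.nil_mem_kstar _, y, by simp, by simpa using hy⟩, w, ?_, rfl⟩
          rw [← List.nil_append w, ← hc]
          exact Language.join_mem_kstar hM'
        · obtain ⟨a, ⟨u, hu, v, rfl, hv⟩, b, hb, rfl⟩ := ih hne hc.symm hM'
          exact ⟨a, ⟨y ++ u, append_mem_kstar (mem_kstar_of_mem hy) hu, v, by simp, hv⟩, b, hb, rfl⟩
  · rintro ⟨a, ⟨u, hu, v, rfl, hv⟩, b, hb, rfl⟩
    simpa using append_mem_kstar hu (append_mem_kstar (mem_kstar_of_mem hv) hb)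

theorem isRegular_kstar (hL : L.IsRegular) : (L∗).IsRegular := by
  refine .of_finite_range_leftQuotient <| (((finite_range_splitQuotient (L∗) hL).image
    (· * L∗)).insert (L∗)).subset ?_
  rintro _ ⟨x, rfl⟩
  rcases eq_or_ne x [] with rfl | hx
  · exact .inl rfl
  · exact .inr ⟨_, ⟨x, rfl⟩, (leftQuotient_kstar L hx).symm⟩

theorem isRegular_singleton (w : List α) : Language.IsRegular ({w} : Set (List α)) := by
  have finite_suffixes : {v | v <:+ w}.Finite :=
    w.tails.finite_toSet.subset fun v hv => (List.mem_tails _ _).2 hv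
  refine .of_finite_range_leftQuotient (finite_suffixes.powerset.subset ?_)
  rintro _ ⟨x, rfl⟩ v hv
  exact ⟨x, hv⟩

theorem isRegular_empty : Language.IsRegular (∅ : Set (List α)) :=
  .of_finite_range_leftQuotient (Set.finite_range_const (c := (∅ : Set (List α))))

end Language

/-- The rational subsets of a monoid: the smallest family that contains the finite sets and is
closed under unions, products and generation of submonoids. -/
inductive IsRational {M : Type*} [Monoid M] : Set M → Prop
  | empty : IsRational ∅
  | singleton (a : M) : IsRational {a}
  | union {S T : Set M} : IsRational S → IsRational T → IsRational (S ∪ T)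
  | mul {S T : Set M} : IsRational S → IsRational T → IsRational (S * T)
  | closure {S : Set M} : IsRational S → IsRational (Submonoid.closure S : Set M)

namespace IsRational

variable {M N : Type*} [Monoid M] [Monoid N] {S : Set M}

theorem iUnion {ι : Type*} [Finite ι] {S : ι → Set M} (h : ∀ i, IsRational (S i)) :
    IsRational (⋃ i, S i) := by
  suffices ∀ t : Set ι, t.Finite → IsRational (⋃ i ∈ t, S i) by
    simpa using this _ Set.finite_univ
  intro t ht
  induction t, ht using Set.Finite.induction_on with
  | empty => simpa using empty
  | insert _ _ ih =>
    rw [Set.biUnion_insert]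
    exact (h _).union ih

theorem of_finite (h : S.Finite) : IsRational S := by
  have := h.to_subtype
  rw [← Set.iUnion_of_singleton_coe S]
  exact iUnion fun i => singleton _

theorem sep_const (h : IsRational S) (p : Prop) : IsRational {a ∈ S | p} := by
  by_cases hp : p
  · simpa [hp] using h
  · simpa [hp] using empty

theorem image (h : IsRational S) (f : M →* N) : IsRational (f '' S) := by
  induction h with
  | empty => simpa using empty
  | singleton a => simpa using singleton (f a)
  | union _ _ hS hT => simpa [Set.image_union] using hS.union hT
  | mul _ _ hS hT => simpa [Set.image_mul] using hS.mul hT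
  | closure _ hS => simpa [← Submonoid.coe_map, MonoidHom.map_mclosure] using hS.closure

theorem prod (hS : IsRational S) {T : Set N} (hT : IsRational T) : IsRational (S ×ˢ T) := by
  convert! (hS.image (MonoidHom.inl M N)).mul (hT.image (MonoidHom.inr M N))
  ext ⟨a, b⟩
  simp [Set.mem_mul]

theorem inv {G : Type*} [Group G] {S : Set G} (h : IsRational S) : IsRational S⁻¹ := by
  induction h with
  | empty => simpa using empty
  | singleton a => simpa using singleton a⁻¹
  | union _ _ hS hT => simpa using hS.union hT
  | mul _ _ hS hT => simpa using hT.mul hS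
  | closure _ hS => simpa [← Submonoid.coe_inv, ← Submonoid.closure_inv] using hS.closure

theorem exists_finite_subset_closure (h : IsRational S) :
    ∃ T : Set M, T.Finite ∧ S ⊆ Submonoid.closure T := by
  have mono {T U : Set M} (h : T ⊆ U) := SetLike.coe_subset_coe.2 (Submonoid.closure_mono h)
  induction h with
  | empty => exact ⟨∅, Set.finite_empty, Set.empty_subset _⟩
  | singleton a => exact ⟨{a}, Set.finite_singleton a, Submonoid.subset_closure⟩
  | union _ _ hS hT =>
    obtain ⟨A, hA, hSA⟩ := hS
    obtain ⟨B, hB, hTB⟩ := hT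
    exact ⟨A ∪ B, hA.union hB, Set.union_subset (hSA.trans (mono Set.subset_union_left))
      (hTB.trans (mono Set.subset_union_right))⟩
  | mul _ _ hS hT =>
    obtain ⟨A, hA, hSA⟩ := hS
    obtain ⟨B, hB, hTB⟩ := hT
    refine ⟨A ∪ B, hA.union hB, ?_⟩
    rintro _ ⟨a, ha, b, hb, rfl⟩
    exact mul_mem (mono Set.subset_union_left (hSA ha)) (mono Set.subset_union_right (hTB hb))
  | closure _ hS =>
    obtain ⟨T, hT, hST⟩ := hS
    exact ⟨T, hT, Submonoid.closure_le.2 hST⟩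

theorem exists_image_eq (h : IsRational S) {f : N →* M} (hf : Function.Surjective f) :
    ∃ T, IsRational T ∧ f '' T = S := by
  induction h with
  | empty => exact ⟨∅, empty, Set.image_empty f⟩
  | singleton a =>
    obtain ⟨b, rfl⟩ := hf a
    exact ⟨{b}, singleton b, Set.image_singleton⟩
  | union _ _ hS hT =>
    obtain ⟨S, hS, rfl⟩ := hS
    obtain ⟨T, hT, rfl⟩ := hT
    exact ⟨S ∪ T, hS.union hT, Set.image_union f S T⟩
  | mul _ _ hS hT =>
    obtain ⟨S, hS, rfl⟩ := hS
    obtain ⟨T, hT, rfl⟩ := hT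
    exact ⟨S * T, hS.mul hT, Set.image_mul f⟩
  | closure _ hS =>
    obtain ⟨S, hS, rfl⟩ := hS
    exact ⟨Submonoid.closure S, hS.closure, by rw [← Submonoid.coe_map, MonoidHom.map_mclosure]⟩

theorem exists_isRegular {X : Type*} {S : Set (FreeMonoid X)} (h : IsRational S) :
    ∃ L : Language X, L.IsRegular ∧ ∀ w, w ∈ L ↔ FreeMonoid.ofList w ∈ S := by
  induction h with
  | empty => exact ⟨_, isRegular_empty, fun w => Iff.rfl⟩
  | singleton a => exact ⟨_, isRegular_singleton a.toList, fun w => Iff.rfl⟩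
  | union _ _ hS hT =>
    obtain ⟨K, hK, hKS⟩ := hS
    obtain ⟨L, hL, hLT⟩ := hT
    exact ⟨K + L, hK.add hL, fun w => or_congr (hKS w) (hLT w)⟩
  | mul _ _ hS hT =>
    obtain ⟨K, hK, hKS⟩ := hS
    obtain ⟨L, hL, hLT⟩ := hT
    refine ⟨K * L, isRegular_mul hK hL, fun w => ?_⟩
    exact exists_congr fun u => and_congr (hKS u) <| exists_congr fun v =>
      and_congr_left' (hLT v)
  | closure _ hS =>
    obtain ⟨L, hL, hLS⟩ := hS
    refine ⟨L∗, isRegular_kstar hL, fun w => ?_⟩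
    rw [Language.mem_kstar]
    constructor
    · rintro ⟨W, rfl, hW⟩
      rw [FreeMonoid.ofList_flatten]
      exact list_prod_mem <| List.forall_mem_map.2 fun u hu =>
        Submonoid.subset_closure ((hLS u).1 (hW u hu))
    · intro hw
      obtain ⟨W, hW, hWw⟩ := Submonoid.exists_list_of_mem_closure hw
      refine ⟨W.map FreeMonoid.toList, ?_, List.forall_mem_map.2 fun u hu => (hLS _).2 (hW u hu)⟩
      rw [← FreeMonoid.toList_prod, hWw, FreeMonoid.toList_ofList]

end IsRational

/-- The least solution of the right-linear system of equations `Y p = F p ∪ ⋃ q ∈ T, R p q * Y q`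
for sets `Y p` of elements of a monoid; the set `T` of states that may be entered serves to
eliminate the states one at a time. -/
inductive LinearSolution {M Q : Type*} [Monoid M] (T : Set Q) (R : Q → Q → Set M) (F : Q → Set M) :
    Q → M → Prop
  | base {p : Q} {a : M} : a ∈ F p → LinearSolution T R F p a
  | step {p q : Q} {a b : M} : q ∈ T → a ∈ R p q → LinearSolution T R F q b →
      LinearSolution T R F p (a * b)

namespace LinearSolution

variable {M Q : Type*} [Monoid M] {T : Set Q} {R : Q → Q → Set M} {F : Q → Set M} {s p : Q} {a : M}

theorem closure_mul (ha : a ∈ Submonoid.closure (R s s)) {b : M}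
    (hb : LinearSolution (insert s T) R F s b) : LinearSolution (insert s T) R F s (a * b) := by
  induction ha using Submonoid.closure_induction generalizing b with
  | mem x hx => exact step (.inl rfl) hx hb
  | one => simpa only [one_mul] using hb
  | mul x y _ _ hx hy => simpa only [mul_assoc] using hx (hy hb)

theorem insert_iff :
    LinearSolution (insert s T) R F p a ↔ LinearSolution T
      (fun p q => R p q ∪ R p s * (Submonoid.closure (R s s) * R s q))
      (fun p => F p ∪ R p s * (Submonoid.closure (R s s) * F s)) p a := by
  constructor
  · have absorb_loop {v : M} {V : Set M} (hv : v ∈ V ∪ R s s * (Submonoid.closure (R s s) * V)) :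
        v ∈ (Submonoid.closure (R s s) : Set M) * V := by
      rcases hv with hv | ⟨x, hx, _, ⟨y, hy, z, hz, rfl⟩, rfl⟩
      · exact ⟨1, one_mem _, v, hv, one_mul v⟩
      · exact ⟨x * y, mul_mem (Submonoid.subset_closure hx) hy, z, hz, mul_assoc _ _ _⟩
    intro h
    induction h with
    | base h => exact base (.inl h)
    | @step p q a b hq ha _ ih =>
      rcases hq with rfl | hq
      · cases ih with
        | base h => exact base (.inr ⟨a, ha, b, absorb_loop h, rfl⟩)
        | @step _ q' u v hq' hu hv =>
          rw [← mul_assoc]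
          exact step hq' (.inr ⟨a, ha, u, absorb_loop hu, rfl⟩) hv
      · exact step hq (.inl ha) ih
  · intro h
    induction h with
    | base h =>
      rcases h with h | ⟨x, hx, _, ⟨y, hy, z, hz, rfl⟩, rfl⟩
      · exact base h
      · exact step (.inl rfl) hx (closure_mul hy (base hz))
    | step hq ha _ ih =>
      rcases ha with ha | ⟨x, hx, _, ⟨y, hy, z, hz, rfl⟩, rfl⟩
      · exact step (.inr hq) ha ih
      · simp only [mul_assoc]
        exact step (.inl rfl) hx (closure_mul hy (step (.inr hq) hz ih))

theorem empty_iff : LinearSolution ∅ R F p a ↔ a ∈ F p := by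
  refine ⟨fun h => ?_, base⟩
  cases h with
  | base h => exact h
  | step hq => exact hq.elim

theorem isRational_of_finite (hT : T.Finite) (hR : ∀ p q, IsRational (R p q))
    (hF : ∀ p, IsRational (F p)) (p : Q) : IsRational {a | LinearSolution T R F p a} := by
  induction T, hT using Set.Finite.induction_on generalizing R F p with
  | empty =>
    simp only [empty_iff]
    exact hF p
  | insert _ _ ih =>
    simp only [insert_iff]
    exact ih (fun p q => (hR p q).union ((hR _ _).mul ((hR _ _).closure.mul (hR _ _))))
      (fun p => (hF p).union ((hR _ _).mul ((hR _ _).closure.mul (hF _)))) p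

end LinearSolution

section Regular

variable {G : Type*} [Group G] {S : Set G}

theorem linearSolution_dfa_iff {M X σ : Type*} [Monoid M] (A : DFA X σ) (π : FreeMonoid X →* M)
    {p : σ} {a : M} :
    LinearSolution Set.univ (fun p q => (fun x => π (.of x)) '' {x | A.step p x = q})
      (fun p => {a | p ∈ A.accept ∧ a = 1}) p a ↔
    ∃ w : List X, A.evalFrom p w ∈ A.accept ∧ π (.ofList w) = a := by
  constructor
  · intro h
    induction h with
    | base h =>
      obtain ⟨h, rfl⟩ := h
      exact ⟨[], h, map_one π⟩
    | step _ ha _ ih =>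
      obtain ⟨x, rfl, rfl⟩ := ha
      obtain ⟨w, hw, rfl⟩ := ih
      exact ⟨x :: w, hw, map_mul π (.of x) _⟩
  · rintro ⟨w, hw, rfl⟩
    induction w generalizing p with
    | nil => exact .base ⟨hw, map_one π⟩
    | cons x w ih =>
      rw [FreeMonoid.ofList_cons, map_mul]
      exact .step (Set.mem_univ _) ⟨x, rfl, rfl⟩ (ih hw)

theorem IsRegularSubset.isRational (h : IsRegularSubset S) : IsRational S := by
  obtain ⟨X, _, π, L, -, ⟨σ, _, A, rfl⟩, rfl⟩ := h
  have accepted_isRational := LinearSolution.isRational_of_finite Set.finite_univ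
    (R := fun p q => (fun x => π (.of x)) '' {x | A.step p x = q})
    (F := fun p => {g | p ∈ A.accept ∧ g = 1})
    (fun p q => .of_finite ((Set.toFinite _).image _))
    (fun p => .of_finite ((Set.finite_singleton 1).subset fun g hg => hg.2)) A.start
  simp only [linearSolution_dfa_iff] at accepted_isRational
  exact accepted_isRational

theorem IsRational.isRegularSubset (h : IsRational S) (hG : IsRational (Set.univ : Set G)) :
    IsRegularSubset S := by
  obtain ⟨T, hT, hTG⟩ := hG.exists_finite_subset_closure
  obtain ⟨k, f, -, rfl⟩ := hT.fin_param
  have hπ : Function.Surjective (FreeMonoid.lift f) := by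
    rw [← MonoidHom.mrange_eq_top, FreeMonoid.mrange_lift]
    exact top_unique fun g _ => hTG (Set.mem_univ g)
  obtain ⟨S, hS, rfl⟩ := h.exists_image_eq hπ
  obtain ⟨L, hL, hLS⟩ := hS.exists_isRegular
  refine ⟨Fin k, inferInstance, _, L, hπ, hL, Set.ext fun g => ?_⟩
  exact exists_congr fun w => and_congr_left' (hLS w)

end Regular

section PositiveCone

variable {G C : Type*} [Group G] [Group C] {P : Set G} {H : Subgroup G} {g h : G}

namespace IsPositiveCone

theorem isRational_univ (hP : IsPositiveCone P) (h : IsRational P) :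
    IsRational (Set.univ : Set G) := by
  have univ_eq : (Set.univ : Set G) = P ∪ ({1} ∪ P⁻¹) :=
    (Set.eq_univ_of_forall hP.cover).symm
  rw [univ_eq]
  exact h.union ((IsRational.singleton 1).union h.inv)

theorem hasRegularLeftOrder (hP : IsPositiveCone P) (h : IsRational P) :
    HasRegularLeftOrder G := by
  refine ⟨fun a b => a⁻¹ * b ∈ P, ⟨{ trichotomous := ?_, irrefl := ?_, trans := ?_ }, ?_⟩, ?_⟩
  · intro a b hab hba
    rcases hP.cover (a⁻¹ * b) with h | h | h
    · exact absurd h hab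
    · exact inv_mul_eq_one.1 h
    · exact absurd (by simpa using h) hba
  · intro a ha
    exact hP.one_notMem (by simpa using ha)
  · intro a b c hab hbc
    simpa [mul_assoc] using hP.mul_mem _ hab _ hbc
  · intro a b c
    simp [mul_assoc]
  · simpa using h.isRegularSubset (hP.isRational_univ h)

end IsPositiveCone

namespace IsRelPositiveCone

theorem mul_mem_of_mem_subgroup (hP : IsRelPositiveCone P H) (hg : g ∈ P) (hh : h ∈ H) :
    g * h ∈ P := by
  rcases hP.cover (g * h) with h' | h' | h'
  · exact h'
  · exact absurd ((H.mul_mem_cancel_right hh).1 h') (hP.disjoint_subgroup g hg)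
  · refine absurd (inv_mem hh) (hP.disjoint_subgroup _ ?_)
    simpa using hP.mul_mem _ h' _ hg

theorem mem_mul_of_mem_subgroup (hP : IsRelPositiveCone P H) (hh : h ∈ H) (hg : g ∈ P) :
    h * g ∈ P := by
  rcases hP.cover (h * g) with h' | h' | h'
  · exact h'
  · exact absurd ((H.mul_mem_cancel_left hh).1 h') (hP.disjoint_subgroup g hg)
  · refine absurd (inv_mem hh) (hP.disjoint_subgroup _ ?_)
    simpa using hP.mul_mem _ hg _ h'

theorem union_image {f : C →* G} (hf : Function.Injective f) (hP : IsRelPositiveCone P f.range)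
    {Q : Set C} (hQ : IsPositiveCone Q) : IsPositiveCone (P ∪ f '' Q) where
  mul_mem := by
    rintro g (hg | ⟨c, hc, rfl⟩) h (hh | ⟨d, hd, rfl⟩)
    · exact .inl (hP.mul_mem _ hg _ hh)
    · exact .inl (hP.mul_mem_of_mem_subgroup hg ⟨d, rfl⟩)
    · exact .inl (hP.mem_mul_of_mem_subgroup ⟨c, rfl⟩ hh)
    · exact .inr ⟨c * d, hQ.mul_mem _ hc _ hd, map_mul f c d⟩
  cover g := by
    rcases hP.cover g with hg | ⟨c, rfl⟩ | hg
    · exact .inl (.inl hg)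
    · rcases hQ.cover c with hc | rfl | hc
      · exact .inl (.inr ⟨c, hc, rfl⟩)
      · exact .inr (.inl (map_one f))
      · exact .inr (.inr (.inr ⟨c⁻¹, hc, map_inv f c⟩))
    · exact .inr (.inr (.inl hg))
  one_notMem := by
    rintro (h | ⟨c, hc, h⟩)
    · exact hP.disjoint_subgroup 1 h (one_mem _)
    · exact hQ.one_notMem ((map_eq_one_iff f hf).1 h ▸ hc)
  disjoint_inv := by
    rintro g (hg | ⟨c, hc, rfl⟩) (hg' | ⟨d, hd, h⟩)
    · exact hP.disjoint_inv g hg hg'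
    · exact hP.disjoint_subgroup g hg (inv_mem_iff.1 ⟨d, h⟩)
    · exact hP.disjoint_subgroup _ hg' (inv_mem ⟨c, rfl⟩)
    · rw [← map_inv, hf.eq_iff] at h
      exact hQ.disjoint_inv c hc (h ▸ hd)

end IsRelPositiveCone

end PositiveCone

/-- An integer valued quasimorphism of defect at most `1` that vanishes on the subgroup `H` and is
odd elsewhere. The defect is measured on the pair `g`, `g⁻¹ * h`, whose product is `h`. -/
structure IsParityQuasimorphism {G : Type*} [Group G] (τ : G → ℤ) (H : Subgroup G) : Prop where
  eq_zero : ∀ g ∈ H, τ g = 0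
  odd : ∀ g ∉ H, Odd (τ g)
  abs_le_one : ∀ g h, |τ (g⁻¹ * h) + τ g - τ h| ≤ 1

namespace IsParityQuasimorphism

variable {G : Type*} [Group G] {τ : G → ℤ} {H : Subgroup G} {g h : G}

theorem mem_of_even (hτ : IsParityQuasimorphism τ H) (hg : Even (τ g)) : g ∈ H := by
  by_contra hgH
  exact Int.not_odd_iff_even.2 hg (hτ.odd g hgH)

theorem eq_of_inv_mul_mem (hτ : IsParityQuasimorphism τ H) (h_mem : g⁻¹ * h ∈ H) :
    τ g = τ h := by
  have defect := abs_le.1 (hτ.abs_le_one g h)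
  rw [hτ.eq_zero _ h_mem] at defect
  by_cases hg : g ∈ H
  · rw [hτ.eq_zero g hg, hτ.eq_zero h ((H.mul_mem_cancel_left (inv_mem hg)).1 h_mem)]
  · have hh : h ∉ H := fun hh => hg (inv_mem_iff.1 ((H.mul_mem_cancel_right hh).1 h_mem))
    obtain ⟨a, ha⟩ := hτ.odd g hg
    obtain ⟨b, hb⟩ := hτ.odd h hh
    lia

theorem map_inv (hτ : IsParityQuasimorphism τ H) (g : G) : τ g⁻¹ = -τ g := by
  have defect := abs_le.1 (hτ.abs_le_one g 1)
  rw [mul_one, hτ.eq_zero 1 (one_mem H)] at defect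
  by_cases hg : g ∈ H
  · rw [hτ.eq_zero g hg, hτ.eq_zero _ (inv_mem hg), neg_zero]
  · obtain ⟨a, ha⟩ := hτ.odd g hg
    obtain ⟨b, hb⟩ := hτ.odd g⁻¹ (mt inv_mem_iff.1 hg)
    lia

theorem map_mul_left (hτ : IsParityQuasimorphism τ H) (hh : h ∈ H) (g : G) :
    τ (h * g) = τ g := by
  have map_inv_eq : τ g⁻¹ = τ (h * g)⁻¹ := hτ.eq_of_inv_mul_mem (by simpa using hh)
  simpa only [hτ.map_inv, neg_inj, eq_comm] using map_inv_eq

end IsParityQuasimorphism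

section ConeSign

variable {G : Type*} [Group G] {P : Set G} {H : Subgroup G} {g : G}

open Classical in
/-- The sign of an element with respect to a relative positive cone `P`: it is `1` on `P`, `-1` on
`P⁻¹`, and `0` on the subgroup. -/
noncomputable def coneSign (P : Set G) (g : G) : ℤ :=
  if g ∈ P then 1 else if g⁻¹ ∈ P then -1 else 0

theorem coneSign_eq_one (hg : g ∈ P) : coneSign P g = 1 :=
  if_pos hg

theorem coneSign_mem (P : Set G) (g : G) : coneSign P g ∈ ({1, -1, 0} : Set ℤ) := by
  unfold coneSign
  split_ifs <;> simp

instance finite_range_coneSign (P : Set G) : Finite (Set.range (coneSign P)) :=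
  (Set.toFinite {1, -1, 0}).subset (Set.range_subset_iff.2 (coneSign_mem P))

namespace IsRelPositiveCone

theorem coneSign_eq_neg_one (hP : IsRelPositiveCone P H) (hg : g⁻¹ ∈ P) : coneSign P g = -1 := by
  rw [coneSign, if_neg fun h => hP.disjoint_inv g h hg, if_pos hg]

theorem coneSign_eq_zero (hP : IsRelPositiveCone P H) (hg : g ∈ H) : coneSign P g = 0 := by
  rw [coneSign, if_neg fun h => hP.disjoint_subgroup g h hg,
    if_neg fun h => hP.disjoint_subgroup _ h (inv_mem hg)]

theorem coneSign_add_le (hP : IsRelPositiveCone P H) (g h : G) :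
    coneSign P g + coneSign P h ≤ coneSign P (g * h) + 1 := by
  have bounds (x : G) : -1 ≤ coneSign P x ∧ coneSign P x ≤ 1 := by
    rcases coneSign_mem P x with hx | hx | hx <;> rw [hx] <;> norm_num
  have := bounds g
  have := bounds h
  have := bounds (g * h)
  rcases hP.cover g with hg | hg | hg
  · rcases hP.cover h with hh | hh | hh
    · rw [coneSign_eq_one (hP.mul_mem g hg h hh)]
      lia
    · rw [coneSign_eq_one (hP.mul_mem_of_mem_subgroup hg hh)]
      lia
    · rw [hP.coneSign_eq_neg_one hh]
      lia
  · rcases hP.cover h with hh | hh | hh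
    · rw [coneSign_eq_one (hP.mem_mul_of_mem_subgroup hg hh)]
      lia
    · rw [hP.coneSign_eq_zero hg, hP.coneSign_eq_zero hh]
      lia
    · rw [hP.coneSign_eq_neg_one hh]
      lia
  · rw [hP.coneSign_eq_neg_one hg]
    lia

theorem coneSign_inv (hP : IsRelPositiveCone P H) (g : G) : coneSign P g⁻¹ = -coneSign P g := by
  rcases hP.cover g with hg | hg | hg
  · rw [coneSign_eq_one hg, hP.coneSign_eq_neg_one (by rwa [inv_inv])]
  · rw [hP.coneSign_eq_zero hg, hP.coneSign_eq_zero (inv_mem hg), neg_zero]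
  · rw [coneSign_eq_one hg, hP.coneSign_eq_neg_one hg, neg_neg]

theorem isParityQuasimorphism_coneSign (hP : IsRelPositiveCone P H) :
    IsParityQuasimorphism (coneSign P) H where
  eq_zero _ := hP.coneSign_eq_zero
  odd g hg := by
    rcases hP.cover g with h | h | h
    · simp [coneSign_eq_one h]
    · exact absurd h hg
    · simp [hP.coneSign_eq_neg_one h]
  abs_le_one g h := by
    have upper := hP.coneSign_add_le g (g⁻¹ * h)
    have lower := hP.coneSign_add_le (g⁻¹ * h)⁻¹ g⁻¹
    rw [mul_inv_cancel_left] at upper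
    rw [← mul_inv_rev, mul_inv_cancel_left] at lower
    simp only [hP.coneSign_inv] at lower
    rw [abs_le]
    lia

theorem isRational_coneSign_eq (hP : IsRelPositiveCone P H) (h : IsRational P) (u : ℤ) :
    IsRational {g | g ∉ H ∧ coneSign P g = u} := by
  have level_eq : {g | g ∉ H ∧ coneSign P g = u} = {g ∈ P | 1 = u} ∪ {g ∈ P⁻¹ | -1 = u} := by
    ext g
    constructor
    · rintro ⟨hg, rfl⟩
      rcases hP.cover g with h | h | h
      · exact .inl ⟨h, (coneSign_eq_one h).symm⟩
      · exact absurd h hg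
      · exact .inr ⟨h, (hP.coneSign_eq_neg_one h).symm⟩
    · rintro (⟨hg, rfl⟩ | ⟨hg, rfl⟩)
      · exact ⟨hP.disjoint_subgroup g hg, coneSign_eq_one hg⟩
      · exact ⟨fun h => hP.disjoint_subgroup _ hg (inv_mem h), hP.coneSign_eq_neg_one hg⟩
  rw [level_eq]
  exact (h.sep_const _).union (h.inv.sep_const _)

end IsRelPositiveCone

end ConeSign

section LiftCone

variable {G C : Type*} [Group G] [Group C] {τ : G → ℤ} {H : Subgroup G}

/-- The subset of `G × ℤ` on which the central coordinate, counted twice, outweighs `-τ`. The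
factor `2` rules out ties where `τ` is odd. -/
def liftCone (τ : G → ℤ) : Set (G × Multiplicative ℤ) :=
  {p | 0 < 2 * p.2.toAdd + τ p.1}

theorem IsParityQuasimorphism.isRelPositiveCone_liftCone (hτ : IsParityQuasimorphism τ H) :
    IsRelPositiveCone (liftCone τ) (H.map (MonoidHom.inl G (Multiplicative ℤ))) where
  mul_mem := by
    rintro ⟨g, m⟩ hg ⟨h, k⟩ hh
    have defect := (abs_le.1 (hτ.abs_le_one g (g * h))).2
    rw [inv_mul_cancel_left] at defect
    simp only [liftCone, Set.mem_ofPred_eq, Prod.mk_mul_mk, toAdd_mul] at hg hh ⊢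
    lia
  cover := by
    rintro ⟨g, m⟩
    rcases lt_trichotomy 0 (2 * m.toAdd + τ g) with h | h | h
    · exact .inl h
    · have hg : g ∈ H := hτ.mem_of_even ⟨-m.toAdd, by lia⟩
      have hm : m.toAdd = 0 := by
        rw [hτ.eq_zero g hg] at h
        lia
      exact .inr (.inl ⟨g, hg, Prod.ext rfl hm.symm⟩)
    · refine .inr (.inr ?_)
      simp only [liftCone, Set.mem_ofPred_eq, Prod.inv_mk, toAdd_inv, hτ.map_inv]
      lia
  disjoint_subgroup := by
    rintro _ h ⟨g, hg, rfl⟩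
    simp [liftCone, hτ.eq_zero g hg] at h
  disjoint_inv := by
    rintro ⟨g, m⟩ h h'
    simp only [liftCone, Set.mem_ofPred_eq, Prod.inv_mk, toAdd_inv, hτ.map_inv] at h h'
    lia

theorem IsParityQuasimorphism.isPositiveCone_liftCone_union {f : C →* G}
    (hτ : IsParityQuasimorphism τ f.range) (hf : Function.Injective f) {Q : Set C}
    (hQ : IsPositiveCone Q) :
    IsPositiveCone (liftCone τ ∪ (MonoidHom.inl G (Multiplicative ℤ)).comp f '' Q) := by
  have cone := hτ.isRelPositiveCone_liftCone
  rw [← MonoidHom.range_comp] at cone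
  exact cone.union_image (fun _ _ h => hf (congrArg Prod.fst h)) hQ

end LiftCone

section Turn

variable {ι : Type*} [LinearOrder ι]

/-- The contribution of the passage from a letter in the factor `i` to a letter in the factor `j`:
`1` if `i < j`, `-1` if `j < i`, and `0` if `i = j` or if one of the two letters is missing. -/
def turn : Option ι → Option ι → ℤ
  | some i, some j => if i < j then 1 else if j < i then -1 else 0
  | _, _ => 0

theorem turn_none_left (o : Option ι) : turn none o = 0 := rfl

theorem turn_none_right (o : Option ι) : turn o none = 0 := by
  cases o <;> rfl

theorem turn_antisymm (o o' : Option ι) : turn o o' = -turn o' o := by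
  rcases o with _ | i <;> rcases o' with _ | j <;> grind [turn]

theorem abs_turn_le_one (o o' : Option ι) : |turn o o'| ≤ 1 := by
  rcases o with _ | i <;> rcases o' with _ | j <;> grind [turn]

theorem odd_turn {i j : ι} (h : i ≠ j) : Odd (turn (some i) (some j)) := by
  rcases lt_or_gt_of_ne h with h | h <;> simp [turn, h, h.not_gt]

theorem abs_turn_sub_turn_sub_turn_le_one (o o' : Option ι) (i : ι) :
    |turn o o' - turn o (some i) - turn (some i) o'| ≤ 1 := by
  rcases o with _ | j <;> rcases o' with _ | k <;> grind [turn]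

end Turn

section Weight

open Monoid Monoid.PushoutI

variable {ι : Type*} [LinearOrder ι] {G : ι → Type*} {C : Type*} [∀ i, Group (G i)] [Group C]
  {φ : ∀ i, C →* G i} {e : ∀ i, G i → ℤ} {o o' : Option ι} {i : ι} {k k' : ℤ} {g h : PushoutI φ}

/-- `HasWeight φ e o k g` states that `g = x₁ * ⋯ * xₙ * c` for some `c` in the amalgamated subgroup
and letters `x₁, …, xₙ` outside of it, consecutive ones taken from different factors, such that the
values `e` of the letters and the turns between consecutive letters add up to `k`. The index `o` is
the factor of `x₁`, or `none` if there is no letter. -/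
inductive HasWeight (φ : ∀ i, C →* G i) (e : ∀ i, G i → ℤ) : Option ι → ℤ → PushoutI φ → Prop
  | of_base (c : C) : HasWeight φ e none 0 (base φ c)
  | of_mul {i : ι} {x : G i} {o : Option ι} {k : ℤ} {g : PushoutI φ} : x ∉ (φ i).range →
      o ≠ some i → HasWeight φ e o k g →
      HasWeight φ e (some i) (e i x + turn (some i) o + k) (of i x * g)

namespace HasWeight

theorem mem_range_of_none (hg : HasWeight φ e none k g) : g ∈ (base φ).range := by
  cases hg with
  | of_base c => exact ⟨c, rfl⟩

theorem eq_zero_of_none (hg : HasWeight φ e none k g) : k = 0 := by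
  cases hg with
  | of_base c => rfl

theorem exists_reduced (hg : HasWeight φ e o k g) :
    ∃ w : CoprodI.Word G, Reduced φ w ∧ w.fstIdx = o ∧ ∃ c, g = ofCoprodI w.prod * base φ c := by
  induction hg with
  | of_base c => exact ⟨.empty, by simp [Reduced, CoprodI.Word.empty], rfl, c, by simp⟩
  | @of_mul i x _ _ _ hx ho _ ih =>
    obtain ⟨w, hw, rfl, c, rfl⟩ := ih
    have x_ne_one : x ≠ 1 := fun h => hx (h ▸ one_mem _)
    refine ⟨.cons x w ho x_ne_one, ?_, CoprodI.Word.fstIdx_cons .., c, ?_⟩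
    · exact List.forall_mem_cons.2 ⟨hx, hw⟩
    · rw [CoprodI.Word.prod_cons, map_mul, ofCoprodI_of, mul_assoc]

theorem eq_none_iff_mem_range (hφ : ∀ i, Function.Injective (φ i)) (hg : HasWeight φ e o k g) :
    o = none ↔ g ∈ (base φ).range := by
  constructor
  · rintro rfl
    exact hg.mem_range_of_none
  · intro h
    obtain ⟨w, hw, rfl, c, rfl⟩ := hg.exists_reduced
    rw [Subgroup.mul_mem_cancel_right _ (MonoidHom.mem_range.2 ⟨c, rfl⟩)] at h
    rw [hw.eq_empty_of_mem_range hφ h]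
    rfl

variable (he : ∀ i, IsParityQuasimorphism (e i) (φ i).range)
include he

theorem base_mul (hg : HasWeight φ e o k g) (c : C) : HasWeight φ e o k (base φ c * g) := by
  cases hg with
  | of_base d =>
    rw [← map_mul]
    exact of_base _
  | @of_mul i x _ _ _ hx ho hg =>
    rw [← of_apply_eq_base φ i, ← mul_assoc, ← map_mul, ← (he i).map_mul_left ⟨c, rfl⟩ x]
    exact of_mul (mt (Subgroup.mul_mem_cancel_left _ (MonoidHom.mem_range.2 ⟨c, rfl⟩)).1 hx) ho hg

theorem inv_mul_of_ne (hg : HasWeight φ e o k g) (hh : HasWeight φ e o' k' h)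
    (hne : ∀ i, o = some i → o' ≠ some i) :
    ∃ o'', HasWeight φ e o'' (-k + turn o o' + k') (g⁻¹ * h) := by
  induction hg generalizing o' k' h with
  | of_base c =>
    rw [← map_inv, turn_none_left, neg_zero, zero_add, zero_add]
    exact ⟨o', hh.base_mul he _⟩
  | @of_mul i x o k g hx ho _ ih =>
    have xh_weight := of_mul (mt inv_mem_iff.1 hx) (hne i rfl) hh
    obtain ⟨o'', h_weight⟩ := ih xh_weight fun j hj hij => ho (hj.trans hij.symm)
    refine ⟨o'', ?_⟩
    convert! h_weight using 1
    · rw [(he i).map_inv, turn_antisymm o]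
      ring
    · rw [map_inv, mul_inv_rev, mul_assoc]

theorem exists_inv_mul_of_ne (hg : HasWeight φ e o k g) (hh : HasWeight φ e o' k' h)
    (hne : ∀ i, o = some i → o' ≠ some i) :
    ∃ o'' k'', HasWeight φ e o'' k'' (g⁻¹ * h) ∧ |k'' + k - k'| ≤ 1 := by
  obtain ⟨o'', h_weight⟩ := hg.inv_mul_of_ne he hh hne
  refine ⟨o'', _, h_weight, ?_⟩
  convert abs_turn_le_one o o' using 2
  ring

theorem exists_inv_mul (hg : HasWeight φ e o k g) (hh : HasWeight φ e o' k' h) :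
    ∃ o'' k'', HasWeight φ e o'' k'' (g⁻¹ * h) ∧ |k'' + k - k'| ≤ 1 := by
  induction hg generalizing o' k' h with
  | of_base c => exact (of_base c).exists_inv_mul_of_ne he hh (by simp)
  | @of_mul i x o k g hx ho hg ih =>
    rcases ne_or_eq o' (some i) with ho' | rfl
    · exact (of_mul hx ho hg).exists_inv_mul_of_ne he hh fun j hj hj' => ho' (hj'.trans hj.symm)
    cases hh with
    | @of_mul _ y o' k' h hy ho' hh =>
      have cancel : (of i x * g)⁻¹ * (of i y * h) = g⁻¹ * (of i (x⁻¹ * y) * h) := by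
        rw [mul_inv_rev, map_mul, map_inv]
        group
      by_cases hxy : x⁻¹ * y ∈ (φ i).range
      · have exy : e i x = e i y := (he i).eq_of_inv_mul_mem hxy
        obtain ⟨c, hc⟩ := hxy
        rw [cancel, ← hc, of_apply_eq_base, exy]
        rcases eq_or_ne o o' with rfl | hoo'
        · obtain ⟨o'', k'', h_weight, h_le⟩ := ih (hh.base_mul he c)
          refine ⟨o'', k'', h_weight, ?_⟩
          convert h_le using 2
          ring
        · obtain ⟨o'', h_weight⟩ := hg.inv_mul_of_ne he (hh.base_mul he c)
            fun j hj hj' => hoo' (hj.trans hj'.symm)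
          refine ⟨o'', _, h_weight, ?_⟩
          convert abs_turn_sub_turn_sub_turn_le_one o o' i using 2
          rw [turn_antisymm o (some i)]
          ring
      · obtain ⟨o'', h_weight⟩ := hg.inv_mul_of_ne he (of_mul hxy ho' hh)
          fun j hj hij => ho (hj.trans hij.symm)
        rw [cancel]
        refine ⟨o'', _, h_weight, ?_⟩
        convert (he i).abs_le_one x y using 2
        rw [turn_antisymm o (some i)]
        ring

theorem exists_hasWeight (g : PushoutI φ) : ∃ o k, HasWeight φ e o k g := by
  induction g using PushoutI.induction_on with
  | of i x =>
    by_cases hx : x ∈ (φ i).range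
    · obtain ⟨c, rfl⟩ := hx
      rw [of_apply_eq_base]
      exact ⟨_, _, of_base c⟩
    · have x_weight : HasWeight φ e _ _ (of i x * base φ 1) := of_mul hx (by simp) (of_base 1)
      rw [map_one, mul_one] at x_weight
      exact ⟨_, _, x_weight⟩
  | base c => exact ⟨_, _, of_base c⟩
  | mul g h hg hh =>
    obtain ⟨o, k, hg⟩ := hg
    obtain ⟨o', k', hh⟩ := hh
    obtain ⟨_, _, hg_inv, -⟩ := hg.exists_inv_mul he (of_base 1)
    obtain ⟨_, _, hgh, -⟩ := hg_inv.exists_inv_mul he hh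
    rw [map_one, mul_one, inv_inv] at hgh
    exact ⟨_, _, hgh⟩

theorem odd (hg : HasWeight φ e (some i) k g) : Odd k := by
  generalize hi : some i = o at hg
  induction hg generalizing i with
  | of_base => cases hi
  | @of_mul j x o k g hx ho hg ih =>
    have hex := (he j).odd x hx
    cases o with
    | none => simpa [turn_none_right, hg.eq_zero_of_none] using hex
    | some l => exact (hex.add_odd (odd_turn fun h => ho (congrArg some h.symm))).add_odd (ih rfl)

theorem odd_iff (hg : HasWeight φ e o k g) : Odd k ↔ o ≠ none := by
  cases o with
  | none => simp [hg.eq_zero_of_none]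
  | some i => exact iff_of_true (hg.odd he) (Option.some_ne_none i)

theorem unique (hφ : ∀ i, Function.Injective (φ i)) (hg : HasWeight φ e o k g)
    (hg' : HasWeight φ e o' k' g) : k = k' := by
  obtain ⟨o'', k'', h_weight, h_le⟩ := hg.exists_inv_mul he hg'
  rw [inv_mul_cancel] at h_weight
  obtain rfl := (h_weight.eq_none_iff_mem_range hφ).2 (one_mem _)
  have parity : Odd k ↔ Odd k' := by
    rw [hg.odd_iff he, hg'.odd_iff he, ne_eq, ne_eq, hg.eq_none_iff_mem_range hφ,
      hg'.eq_none_iff_mem_range hφ]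
  rw [h_weight.eq_zero_of_none, abs_le] at h_le
  rw [Int.odd_iff, Int.odd_iff] at parity
  lia

end HasWeight

/-- The weight of an element of a free product with amalgamation. The value is a junk one for
elements that admit no weight or several, which `HasWeight.exists_hasWeight` and `HasWeight.unique`
exclude. -/
noncomputable def weight (φ : ∀ i, C →* G i) (e : ∀ i, G i → ℤ) (g : PushoutI φ) : ℤ :=
  Classical.epsilon fun k => ∃ o, HasWeight φ e o k g

section

variable (hφ : ∀ i, Function.Injective (φ i)) (he : ∀ i, IsParityQuasimorphism (e i) (φ i).range)
include hφ he

theorem HasWeight.weight_eq (hg : HasWeight φ e o k g) : weight φ e g = k := by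
  obtain ⟨o', hg'⟩ := Classical.epsilon_spec (p := fun k => ∃ o, HasWeight φ e o k g) ⟨k, o, hg⟩
  exact hg'.unique he hφ hg

theorem isParityQuasimorphism_weight :
    IsParityQuasimorphism (weight φ e) (base φ).range where
  eq_zero := by
    rintro _ ⟨c, rfl⟩
    exact (HasWeight.of_base c).weight_eq hφ he
  odd g hg := by
    obtain ⟨o, k, h_weight⟩ := HasWeight.exists_hasWeight he g
    rw [h_weight.weight_eq hφ he, h_weight.odd_iff he, ne_eq, h_weight.eq_none_iff_mem_range hφ]
    exact hg
  abs_le_one g h := by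
    obtain ⟨o, k, hg⟩ := HasWeight.exists_hasWeight he g
    obtain ⟨o', k', hh⟩ := HasWeight.exists_hasWeight he h
    obtain ⟨o'', k'', hgh, h_le⟩ := hg.exists_inv_mul he hh
    rwa [hgh.weight_eq hφ he, hg.weight_eq hφ he, hh.weight_eq hφ he]

end

end Weight

section Rationality

open Monoid Monoid.PushoutI

theorem isRational_setOf_pos (n : ℤ) : IsRational {m : Multiplicative ℤ | 0 < 2 * m.toAdd + n} := by
  convert! (IsRational.singleton (Multiplicative.ofAdd (-n / 2 + 1))).mul
    (IsRational.singleton (Multiplicative.ofAdd (1 : ℤ))).closure using 1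
  ext m
  rw [Set.mem_ofPred_eq, Set.singleton_mul, Set.mem_image]
  constructor
  · intro hm
    refine ⟨Multiplicative.ofAdd (m.toAdd - (-n / 2 + 1)), ?_, by simp⟩
    refine Submonoid.mem_closure_singleton.2 ⟨(m.toAdd - (-n / 2 + 1)).toNat, ?_⟩
    rw [← ofAdd_nsmul, nsmul_one, Int.toNat_of_nonneg (by lia)]
  · rintro ⟨_, hk, rfl⟩
    obtain ⟨k, rfl⟩ := Submonoid.mem_closure_singleton.1 hk
    rw [← ofAdd_nsmul, ← ofAdd_add, toAdd_ofAdd, nsmul_one]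
    lia

variable {ι : Type*} {G : ι → Type*} {C : Type*} [∀ i, Group (G i)] [Group C]
  {φ : ∀ i, C →* G i} {e : ∀ i, G i → ℤ} {i : ι} {p : PushoutI φ × Multiplicative ℤ}

/-- The pairs accepted in the state `i` by the automaton that reads reduced words: a last letter of
the factor `i` times an element of the amalgamated subgroup, and a central element that outweighs
the letter. -/
def weightFinal (φ : ∀ i, C →* G i) (e : ∀ i, G i → ℤ) (i : ι) :
    Set (PushoutI φ × Multiplicative ℤ) :=
  {p | ∃ x ∉ (φ i).range, (∃ c, of i x * base φ c = p.1) ∧ 0 < 2 * p.2.toAdd + e i x}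

theorem isRational_weightFinal [∀ i, Finite (Set.range (e i))]
    (h : ∀ i u, IsRational {x | x ∉ (φ i).range ∧ e i x = u}) (hC : IsRational (Set.univ : Set C))
    (i : ι) : IsRational (weightFinal φ e i) := by
  have final_eq : weightFinal φ e i = ⋃ u : Set.range (e i),
      ((of i '' {x | x ∉ (φ i).range ∧ e i x = u}) * base φ '' Set.univ) ×ˢ
        {m : Multiplicative ℤ | 0 < 2 * m.toAdd + u} := by
    ext ⟨g, m⟩
    rw [Set.mem_iUnion]
    constructor
    · rintro ⟨x, hx, ⟨c, hxc⟩, hm⟩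
      exact ⟨⟨_, x, rfl⟩, ⟨_, ⟨x, ⟨hx, rfl⟩, rfl⟩, _, ⟨c, Set.mem_univ c, rfl⟩, hxc⟩, hm⟩
    · rintro ⟨u, ⟨_, ⟨x, ⟨hx, hxu⟩, rfl⟩, _, ⟨c, -, rfl⟩, hxc⟩, hm⟩
      exact ⟨x, hx, ⟨c, hxc⟩, hxu ▸ hm⟩
  rw [final_eq]
  exact .iUnion fun u => (((h i u).image _).mul (hC.image _)).prod (isRational_setOf_pos u)

variable [LinearOrder ι]

/-- The transitions of the automaton that reads reduced words: a letter `x` of the factor `i` that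
is followed by a letter of the factor `j`, paired with the central element that compensates for the
resulting contribution to the weight. -/
def weightStep (φ : ∀ i, C →* G i) (e : ∀ i, G i → ℤ) (i j : ι) :
    Set (PushoutI φ × Multiplicative ℤ) :=
  {p | i ≠ j ∧ ∃ x ∉ (φ i).range, of i x = p.1 ∧
    2 * p.2.toAdd + e i x + turn (some i) (some j) = 0}

theorem isRational_weightStep [∀ i, Finite (Set.range (e i))]
    (h : ∀ i u, IsRational {x | x ∉ (φ i).range ∧ e i x = u}) (i j : ι) :
    IsRational (weightStep φ e i j) := by
  have step_eq : weightStep φ e i j = ⋃ u : Set.range (e i),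
      (of i '' {x | x ∉ (φ i).range ∧ e i x = u}) ×ˢ
        {m : Multiplicative ℤ | i ≠ j ∧ 2 * m.toAdd + u + turn (some i) (some j) = 0} := by
    ext ⟨g, m⟩
    rw [Set.mem_iUnion]
    constructor
    · rintro ⟨hij, x, hx, hxg, hm⟩
      exact ⟨⟨_, x, rfl⟩, ⟨x, ⟨hx, rfl⟩, hxg⟩, hij, hm⟩
    · rintro ⟨u, ⟨x, ⟨hx, hxu⟩, hxg⟩, hij, hm⟩
      exact ⟨hij, x, hx, hxg, hxu ▸ hm⟩
  rw [step_eq]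
  refine .iUnion fun u => ((h i u).image _).prod (.of_finite (Set.Subsingleton.finite ?_))
  rintro m ⟨-, hm⟩ m' ⟨-, hm'⟩
  exact Multiplicative.toAdd.injective (by lia)

theorem exists_hasWeight_of_linearSolution
    (h : LinearSolution Set.univ (weightStep φ e) (weightFinal φ e) i p) :
    ∃ k, HasWeight φ e (some i) k p.1 ∧ 0 < 2 * p.2.toAdd + k := by
  induction h with
  | base h =>
    obtain ⟨x, hx, ⟨c, hxc⟩, hpos⟩ := h
    refine ⟨_, hxc ▸ HasWeight.of_mul hx (by simp) (.of_base c), ?_⟩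
    simpa [turn_none_right] using hpos
  | step _ ha _ ih =>
    obtain ⟨hij, x, hx, hxa, hturn⟩ := ha
    obtain ⟨k, hk, hpos⟩ := ih
    rw [Prod.fst_mul, Prod.snd_mul, toAdd_mul, ← hxa]
    exact ⟨_, .of_mul hx (by simpa using hij.symm) hk, by lia⟩

theorem linearSolution_of_hasWeight (he : ∀ i, ∀ x ∉ (φ i).range, Odd (e i x)) {g : PushoutI φ}
    {k : ℤ} (hg : HasWeight φ e (some i) k g) {m : Multiplicative ℤ} (hm : 0 < 2 * m.toAdd + k) :
    LinearSolution Set.univ (weightStep φ e) (weightFinal φ e) i (g, m) := by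
  generalize hi : some i = o at hg
  induction hg generalizing i m with
  | of_base => cases hi
  | @of_mul j x o k g hx ho hg ih =>
    obtain rfl := Option.some_inj.1 hi
    cases o with
    | none =>
      obtain ⟨c, rfl⟩ := hg.mem_range_of_none
      refine .base ⟨x, hx, ⟨c, rfl⟩, ?_⟩
      simpa [turn_none_right, hg.eq_zero_of_none] using hm
    | some j =>
      have hij : i ≠ j := fun h => ho (congrArg some h.symm)
      obtain ⟨a, ha⟩ := (he i x hx).add_odd (odd_turn hij)
      have split : (of i x * g, m) = (of i x, .ofAdd (-a)) * (g, .ofAdd a * m) := by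
        rw [Prod.mk_mul_mk, ← mul_assoc, ← ofAdd_add, neg_add_cancel, ofAdd_zero, one_mul]
      rw [split]
      refine .step (Set.mem_univ j) ⟨hij, x, hx, rfl, ?_⟩ (ih ?_ rfl)
      · rw [toAdd_ofAdd]
        lia
      · rw [toAdd_mul, toAdd_ofAdd]
        lia

theorem liftCone_weight_eq (hφ : ∀ i, Function.Injective (φ i))
    (he : ∀ i, IsParityQuasimorphism (e i) (φ i).range) :
    liftCone (weight φ e) =
      (⋃ i, {p | LinearSolution Set.univ (weightStep φ e) (weightFinal φ e) i p}) ∪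
        (base φ '' Set.univ) ×ˢ {m : Multiplicative ℤ | 0 < 2 * m.toAdd + 0} := by
  ext ⟨g, m⟩
  rw [Set.mem_union, Set.mem_iUnion]
  constructor
  · intro hm
    obtain ⟨o, k, hg⟩ := HasWeight.exists_hasWeight he g
    rw [liftCone, Set.mem_ofPred_eq, hg.weight_eq hφ he] at hm
    cases o with
    | none =>
      obtain ⟨c, rfl⟩ := hg.mem_range_of_none
      exact .inr ⟨⟨c, Set.mem_univ c, rfl⟩, hg.eq_zero_of_none ▸ hm⟩
    | some i => exact .inl ⟨i, linearSolution_of_hasWeight (fun i => (he i).odd) hg hm⟩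
  · rintro (⟨i, h⟩ | ⟨⟨c, -, rfl⟩, hm⟩)
    · obtain ⟨k, hg, hpos⟩ := exists_hasWeight_of_linearSolution h
      rwa [liftCone, Set.mem_ofPred_eq, hg.weight_eq hφ he]
    · rwa [liftCone, Set.mem_ofPred_eq, (HasWeight.of_base c).weight_eq hφ he]

theorem isRational_liftCone_weight [Finite ι] [∀ i, Finite (Set.range (e i))]
    (hφ : ∀ i, Function.Injective (φ i)) (he : ∀ i, IsParityQuasimorphism (e i) (φ i).range)
    (h : ∀ i u, IsRational {x | x ∉ (φ i).range ∧ e i x = u})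
    (hC : IsRational (Set.univ : Set C)) : IsRational (liftCone (weight φ e)) := by
  rw [liftCone_weight_eq hφ he]
  exact (IsRational.iUnion fun i => LinearSolution.isRational_of_finite Set.finite_univ
    (isRational_weightStep h) (isRational_weightFinal h hC) i).union
    ((hC.image _).prod (isRational_setOf_pos 0))

end Rationality

end RegularOrder

open RegularOrder in
/-- The groups `G i` contain the common subgroup `C` through the injective homomorphisms `φ i`, and
`Monoid.PushoutI φ` is the free product of the `G i` amalgamated over `C`. -/
theorem mainTheorem7 (n : ℕ) (G : Fin n → Type*) [∀ i, Group (G i)]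
    (C : Type*) [Group C] (φ : ∀ i, C →* G i)
    (hφ : ∀ i, Function.Injective (φ i))
    (hfg : ∀ i, Group.FG (G i))
    (hG : ∀ i, HasRegularRelPositiveCone (φ i).range)
    (hC : HasRegularPositiveCone C) :
    HasRegularLeftOrder (Monoid.PushoutI φ × Multiplicative ℤ) := by
  choose P hP hPr using hG
  obtain ⟨Q, hQ, hQr⟩ := hC
  have signs i := (hP i).isParityQuasimorphism_coneSign
  have hbase := Monoid.PushoutI.base_injective hφ
  refine ((isParityQuasimorphism_weight hφ signs).isPositiveCone_liftCone_union hbase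
    hQ).hasRegularLeftOrder ?_
  have sign_levels i := (hP i).isRational_coneSign_eq (hPr i).isRational
  exact (isRational_liftCone_weight hφ signs sign_levels (hQ.isRational_univ hQr.isRational)).union
    (hQr.isRational.image _)
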